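/- Let $G\in\mathbb R^{N\times L}$ ($L\ge 1$) have no zero column, and put $\theta_{\max}=\max_{1\le i\le L}\|Ge_i\|_2$, $\theta_{\min}=\min_{1\le i\le L}\|Ge_i\|_2>0$, $\mu=\theta_{\max}^2/\theta_{\min}^2\ge 1$ and $\theta_{\mathrm{avg}}^2=(\theta_{\max}^2+\theta_{\min}^2)/2$. Let $\phi_1,\dots,\phi_K$ be random vectors in $\{\pm1\}^L$ all of whose $KL$ entries are independent and take the values $1$ and $-1$ with probability $1/2$ each, let $D_{\phi_k}$ be the diagonal matrix with diagonal $\phi_k$, and let $H\in\mathbb R^{KN\times L}$ be the matrix obtained by stacking the blocks $GD_{\phi_1},\dots,GD_{\phi_K}$ on top of each other. There are absolute constants $c,C>0$ such that for all $N,L,K,S$, all such $G$ and all $\delta\in(0,1)$: if $$K\ \ge\ c\,\delta^{-2}\mu^2 S\log L ,$$ then with probability at least $$1-2\exp\Bigl(-CK\min\Bigl\{\frac{\delta}{2\mu},\frac{\delta^2}{(2\mu)^2}\Bigr\}\Bigr)$$ the inequality $$\left|\frac{\|Hx\|_2^2}{K\theta_{\mathrm{avg}}^2}-1\right|\ \le\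 \frac{\mu-1+2\delta}{\mu+1}$$ holds for all $x\in\mathbb R^L$ with $\|x\|_2=1$ and at most $S$ nonzero entries. In other words, on this event the scaled matrix $A=\frac{1}{\sqrt K\,\theta_{\mathrm{avg}}}H$ has the restricted isometry property of order $S$ with constant $\varepsilon=\frac{\mu-1+2\delta}{\mu+1}\in(0,1)$: $(1-\varepsilon)\|x\|_2^2\le\|Ax\|_2^2\le(1+\varepsilon)\|x\|_2^2$ for all $x$ with at most $S$ nonzero entries. -/

import Mathlib

open MeasureTheory ProbabilityTheory

namespace MaskImaging

noncomputable section

/-- The law of a random sign: the values `1` and `-1` with probability `1/2` each. -/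
def rademacher : Measure ℝ :=
  (2⁻¹ : ENNReal) • Measure.dirac (1 : ℝ) + (2⁻¹ : ENNReal) • Measure.dirac (-1 : ℝ)

/-- The measurement matrix `H`: the `K` blocks `G * D_{φ₁}, …, G * D_{φ_K}` stacked on top of each
other. The row with index `(k, n)` is the `n`-th row of the `k`-th block. -/
def measurementMatrix {N L K : ℕ} (G : Matrix (Fin N) (Fin L) ℝ) (φ : Fin K → Fin L → ℝ) :
    Matrix (Fin K × Fin N) (Fin L) ℝ :=
  Matrix.of fun p l => (G * Matrix.diagonal (φ p.1)) p.2 l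

/-- The Euclidean norm of the `i`-th column `G eᵢ` of `G`. -/
def colNorm {N L : ℕ} (G : Matrix (Fin N) (Fin L) ℝ) (i : Fin L) : ℝ :=
  ‖Matrix.toEuclideanLin G (EuclideanSpace.single i (1 : ℝ))‖

/-- The largest column norm (a maximum over a finite set, nonempty when `0 < L`). -/
def thetaMax {N L : ℕ} (G : Matrix (Fin N) (Fin L) ℝ) : ℝ := ⨆ i, colNorm G i

/-- The smallest column norm (a minimum over a finite set, nonempty when `0 < L`). -/
def thetaMin {N L : ℕ} (G : Matrix (Fin N) (Fin L) ℝ) : ℝ := ⨅ i, colNorm G i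

/-- The ratio `μ = θ_max² / θ_min²`. -/
def condRatio {N L : ℕ} (G : Matrix (Fin N) (Fin L) ℝ) : ℝ := thetaMax G ^ 2 / thetaMin G ^ 2

/-- The averaged squared column norm `θ_avg² = (θ_max² + θ_min²) / 2`. -/
def thetaAvgSq {N L : ℕ} (G : Matrix (Fin N) (Fin L) ℝ) : ℝ :=
  (thetaMax G ^ 2 + thetaMin G ^ 2) / 2

/-- A vector with at most `S` nonzero entries. -/
def IsSparse {L : ℕ} (S : ℕ) (x : EuclideanSpace ℝ (Fin L)) : Prop :=
  {i : Fin L | x i ≠ 0}.ncard ≤ S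

/-- The `S`-sparse vectors on the unit sphere of `ℝ^L`. -/
def sparseSphere (S L : ℕ) : Set (EuclideanSpace ℝ (Fin L)) :=
  {x | ‖x‖ = 1 ∧ IsSparse S x}

/-- The restricted isometry property of order `S` with constant `ε ∈ (0, 1)`. -/
def HasRIP {ι : Type*} [Fintype ι] {L : ℕ} (A : Matrix ι (Fin L) ℝ) (S : ℕ) (ε : ℝ) : Prop :=
  0 < ε ∧ ε < 1 ∧ ∀ x : EuclideanSpace ℝ (Fin L), IsSparse S x →
    (1 - ε) * ‖x‖ ^ 2 ≤ ‖Matrix.toEuclideanLin A x‖ ^ 2 ∧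
      ‖Matrix.toEuclideanLin A x‖ ^ 2 ≤ (1 + ε) * ‖x‖ ^ 2

end

end MaskImaging

/-!
For a fixed `x` in the unit ball, `‖H x‖²` is the sum of the `K` independent terms `‖G D_φₖ x‖²`,
with mean `∑ᵢ ‖G eᵢ‖² xᵢ²` between `θ_min² ‖x‖²` and `θ_max² ‖x‖²`. The coordinates of `G D_φₖ x`
are sub-Gaussian, and the variance proxies add up to at most a multiple of `θ_max²`. Writing
`exp (s u²)` as a Gaussian average of exponentials linear in `u`, and combining the coordinates by
the convexity of `exp`, one sees that `‖G D_φₖ x‖²` has an exponential moment at a scale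
proportional to `θ_max⁻²`; Bernstein's inequality then bounds the deviation of `‖H x‖²` from its
mean.

This deviation is a quadratic form in `x`. Polarization shows that a quadratic form is bounded on a
unit ball by twice its maximum over a `1/8`-net, so a union bound over nets of the coordinate
subspaces of dimension `min S L`, at most `L ^ (6 S)` vectors altogether, makes the estimate uniform
over the sparse unit vectors.
-/

namespace MaskImaging

open Metric Module
open scoped NNReal ENNReal

section Nets

variable {E : Type*} [NormedAddCommGroup E] [NormedSpace ℝ E] [FiniteDimensional ℝ E]

lemma card_le_of_isSeparated_of_subset_closedBall {ε : ℝ≥0} (hε : 0 < ε) {s : Finset E}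
    (hs : (s : Set E) ⊆ closedBall 0 1) (hsep : IsSeparated ε (s : Set E)) :
    (s.card : ℝ) ≤ (1 + 2 / ε) ^ finrank ℝ E := by
  borelize E
  let ν : Measure E := Measure.addHaar
  have hε2 : (0 : ℝ) < ε / 2 := by positivity
  have hρ : (0 : ℝ) < 1 + ε / 2 := by positivity
  have hdisj : (s : Set E).PairwiseDisjoint fun c => ball c (ε / 2) := fun c hc d hd hcd => by
    refine ball_disjoint_ball ?_
    have : (ε : ℝ≥0∞) < edist c d := hsep hc hd hcd
    rw [edist_nndist, ENNReal.coe_lt_coe, ← NNReal.coe_lt_coe, coe_nndist] at this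
    linarith
  have hsub : ⋃ c ∈ s, ball c (ε / 2 : ℝ) ⊆ ball 0 (1 + ε / 2) :=
    Set.iUnion₂_subset fun c hc => ball_subset_ball' (by linarith [mem_closedBall.1 (hs hc)])
  have hvol : s.card * ENNReal.ofReal ((ε / 2 : ℝ) ^ finrank ℝ E) * ν (ball 0 1) ≤
      ENNReal.ofReal ((1 + ε / 2 : ℝ) ^ finrank ℝ E) * ν (ball 0 1) :=
    calc s.card * ENNReal.ofReal ((ε / 2 : ℝ) ^ finrank ℝ E) * ν (ball 0 1)
        = ν (⋃ c ∈ s, ball c (ε / 2 : ℝ)) := by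
          rw [measure_biUnion_finset hdisj fun _ _ => measurableSet_ball]
          simp only [ν.addHaar_ball_of_pos _ hε2, Finset.sum_const, nsmul_eq_mul, mul_assoc]
      _ ≤ ν (ball 0 (1 + ε / 2 : ℝ)) := measure_mono hsub
      _ = _ := ν.addHaar_ball_of_pos _ hρ
  have hcard := ENNReal.toReal_le_of_le_ofReal (by positivity)
    ((ENNReal.mul_le_mul_iff_left (measure_ball_pos ν _ one_pos).ne' measure_ball_lt_top.ne).1 hvol)
  rw [ENNReal.toReal_mul, ENNReal.toReal_natCast, ENNReal.toReal_ofReal (by positivity),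
    ← le_div_iff₀ (by positivity), ← div_pow] at hcard
  have hratio : (1 + ε / 2 : ℝ) / (ε / 2) = 1 + 2 / ε := by field_simp; ring
  rwa [hratio] at hcard

lemma exists_finset_isCover_closedBall {ε : ℝ≥0} (hε : 0 < ε) :
    ∃ A : Finset E, (A : Set E) ⊆ closedBall 0 1 ∧ IsCover ε (closedBall 0 1) (A : Set E) ∧
      (A.card : ℝ) ≤ (1 + 2 / ε) ^ finrank ℝ E := by
  have : ProperSpace E := FiniteDimensional.proper ℝ E
  obtain ⟨N, -, hN, hcover⟩ := exists_finite_isCover_of_isCompact (half_pos hε).ne'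
    (isCompact_closedBall (0 : E) 1)
  have hpack : packingNumber ε (closedBall (0 : E) 1) ≠ ⊤ := by
    have h := packingNumber_two_mul_le_externalCoveringNumber (ε / 2) (closedBall (0 : E) 1)
    rw [mul_div_cancel₀ _ two_ne_zero] at h
    exact ((h.trans hcover.externalCoveringNumber_le_encard).trans_lt hN.encard_lt_top).ne
  have hfin : (maximalSeparatedSet ε (closedBall (0 : E) 1)).Finite := by
    rwa [← Set.encard_ne_top_iff, encard_maximalSeparatedSet hpack]
  lift maximalSeparatedSet ε (closedBall (0 : E) 1) to Finset E using hfin with A hA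
  have hsub : (A : Set E) ⊆ closedBall 0 1 := hA ▸ maximalSeparatedSet_subset
  exact ⟨A, hsub, hA ▸ isCover_maximalSeparatedSet hpack,
    card_le_of_isSeparated_of_subset_closedBall hε hsub (hA ▸ isSeparated_maximalSeparatedSet)⟩

end Nets

section QuadraticTestSet

section Algebra

variable {E : Type*} [AddCommGroup E] [Module ℝ E]

/-- A set `A` of vectors is a quadratic test set for `B` if a bound for a quadratic form on `A`
yields twice that bound on `B`; it reduces a uniform bound on `B` to a union bound over `A`. -/
def IsQuadraticTestSet (A B : Set E) : Prop :=
  ∀ (q : QuadraticForm ℝ E) (η : ℝ), (∀ y ∈ A, |q y| ≤ η) → ∀ x ∈ B, |q x| ≤ 2 * η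

lemma IsQuadraticTestSet.image {F : Type*} [AddCommGroup F] [Module ℝ F] {A B : Set E}
    (h : IsQuadraticTestSet A B) (f : E →ₗ[ℝ] F) :
    IsQuadraticTestSet (f '' A) (f '' B) := by
  rintro q η hη _ ⟨x, hx, rfl⟩
  exact h (q.comp f) η (fun y hy => hη (f y) (Set.mem_image_of_mem f hy)) x hx

lemma IsQuadraticTestSet.mono_right {A B C : Set E} (h : IsQuadraticTestSet A C) (hBC : B ⊆ C) :
    IsQuadraticTestSet A B :=
  fun q η hη x hx => h q η hη x (hBC hx)

lemma IsQuadraticTestSet.biUnion {ι : Type*} {I : Set ι} {A B : ι → Set E}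
    (h : ∀ i ∈ I, IsQuadraticTestSet (A i) (B i)) :
    IsQuadraticTestSet (⋃ i ∈ I, A i) (⋃ i ∈ I, B i) := by
  intro q η hη x hx
  obtain ⟨i, hi, hxi⟩ := Set.mem_iUnion₂.1 hx
  exact h i hi q η (fun y hy => hη y (Set.mem_biUnion hi hy)) x hxi

/-- The weights `a` and `a⁻¹` balance a short `x - y` against a long `x + y`. -/
lemma quadraticForm_sub_eq (q : QuadraticForm ℝ E) {a : ℝ} (ha : a ≠ 0) (x y : E) :
    q x - q y =
      (q (a • (x - y) + a⁻¹ • (x + y)) - q (a • (x - y) - a⁻¹ • (x + y))) / 4 := by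
  rw [sub_eq_add_neg (a • _), QuadraticMap.map_add q, QuadraticMap.map_add q, q.map_neg,
    q.polar_neg_right, q.polar_smul_left, q.polar_smul_right]
  simp only [smul_eq_mul, q.polar_add_right, q.polar_sub_left, q.polar_self,
    QuadraticMap.polar_comm q y x]
  field_simp
  ring

end Algebra

variable {E : Type*} [NormedAddCommGroup E] [NormedSpace ℝ E]

lemma isQuadraticTestSet_singleton_of_finrank_eq_one (hE : finrank ℝ E = 1)
    {u : E} (hu : ‖u‖ = 1) :
    IsQuadraticTestSet {u} (closedBall 0 1) := by
  intro q η hη x hx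
  obtain ⟨c, rfl⟩ := exists_smul_eq_of_finrank_eq_one hE (norm_ne_zero_iff.1 (hu ▸ one_ne_zero)) x
  have hc : |c| ≤ 1 := by simpa [norm_smul, hu] using hx
  have hqu : |q u| ≤ η := hη u rfl
  calc |q (c • u)| = |c| * |c| * |q u| := by rw [q.map_smul, smul_eq_mul, abs_mul, abs_mul]
    _ ≤ 1 * 1 * η := by gcongr
    _ ≤ 2 * η := by linarith [abs_nonneg (q u)]

section FiniteDimensional

variable [FiniteDimensional ℝ E]

lemma continuous_quadraticForm (q : QuadraticForm ℝ E) : Continuous q := by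
  have h : ⇑q = fun x => (QuadraticMap.associated (R := ℝ) q).toContinuousBilinearMap x x := by
    ext x
    simp only [LinearMap.toContinuousBilinearMap_apply, QuadraticMap.associated_eq_self_apply]
  rw [h]
  fun_prop

lemma isQuadraticTestSet_closedBall_of_isCover {A : Set E} (hA : A ⊆ closedBall 0 1)
    (hcover : IsCover (1 / 8) (closedBall 0 1) A) : IsQuadraticTestSet A (closedBall 0 1) := by
  intro q η hη x hx
  have : ProperSpace E := FiniteDimensional.proper ℝ E
  obtain ⟨z, hz, hmax⟩ := (isCompact_closedBall (0 : E) 1).exists_isMaxOn ⟨x, hx⟩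
    (continuous_quadraticForm q).abs.continuousOn
  obtain ⟨y, hyA, hzy⟩ := Set.mem_iUnion₂.1 (hcover.subset_iUnion_closedBall hz)
  have hz1 : ‖z‖ ≤ 1 := mem_closedBall_zero_iff.1 hz
  have hy1 : ‖y‖ ≤ 1 := mem_closedBall_zero_iff.1 (hA hyA)
  have hp : ‖(4 : ℝ) • (z - y)‖ ≤ 1 / 2 := by
    rw [mem_closedBall, dist_eq_norm] at hzy
    rw [norm_smul]
    norm_num at hzy ⊢
    linarith
  have hr : ‖(4 : ℝ)⁻¹ • (z + y)‖ ≤ 1 / 2 := by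
    rw [norm_smul]
    norm_num
    linarith [norm_add_le z y]
  have hle : ∀ w, ‖w‖ ≤ 1 → |q w| ≤ |q z| := fun w hw => hmax (mem_closedBall_zero_iff.2 hw)
  have hadd := hle _ ((norm_add_le_of_le hp hr).trans (by norm_num))
  have hsub := hle _ ((norm_sub_le_of_le hp hr).trans (by norm_num))
  have hnet : |q z - q y| ≤ |q z| / 2 := by
    rw [quadraticForm_sub_eq q four_ne_zero z y, abs_div, abs_of_pos (zero_lt_four' ℝ)]
    linarith [(abs_sub _ _).trans (add_le_add hadd hsub)]
  have hz2 : |q z| ≤ 2 * η := by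
    linarith [abs_sub_abs_le_abs_sub (q z) (q y), hη y hyA]
  exact (hmax hx).trans hz2

variable (E) in
lemma exists_isQuadraticTestSet_closedBall :
    ∃ A : Finset E, (A : Set E) ⊆ closedBall 0 1 ∧ A.card ≤ 17 ^ finrank ℝ E ∧
      IsQuadraticTestSet (A : Set E) (closedBall 0 1) := by
  obtain ⟨A, hA, hcover, hcard⟩ :=
    exists_finset_isCover_closedBall (E := E) (ε := 1 / 8) (by norm_num)
  refine ⟨A, hA, ?_, isQuadraticTestSet_closedBall_of_isCover hA hcover⟩
  norm_num at hcard
  exact_mod_cast hcard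

end FiniteDimensional

lemma exists_isQuadraticTestSet_submodule (V : Submodule ℝ E) [FiniteDimensional ℝ V] :
    ∃ A : Finset E, (A : Set E) ⊆ closedBall 0 1 ∧ A.card ≤ 17 ^ finrank ℝ V ∧
      IsQuadraticTestSet (A : Set E) (V ∩ closedBall 0 1) := by
  classical
  obtain ⟨A, hA, hcard, htest⟩ := exists_isQuadraticTestSet_closedBall V
  refine ⟨A.image V.subtype, ?_, Finset.card_image_le.trans hcard, ?_⟩
  · rw [Finset.coe_image, Set.image_subset_iff]
    exact fun x hx => by simpa using hA hx
  · have hball : (V : Set E) ∩ closedBall 0 1 = V.subtype '' closedBall 0 1 := by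
      ext x; simp [and_comm]
    rw [hball, Finset.coe_image]
    exact htest.image V.subtype

end QuadraticTestSet

section SparseSphere

variable {L : ℕ}

/-- The subspace of `ℝ^L` of the vectors supported on `T`. -/
def coordSubspace (T : Finset (Fin L)) : Submodule ℝ (EuclideanSpace ℝ (Fin L)) :=
  Submodule.span ℝ ((fun i => EuclideanSpace.single i 1) '' (T : Set (Fin L)))

lemma mem_coordSubspace {T : Finset (Fin L)} {x : EuclideanSpace ℝ (Fin L)}
    (hx : ∀ i, x i ≠ 0 → i ∈ T) : x ∈ coordSubspace T := by
  rw [← (EuclideanSpace.basisFun (Fin L) ℝ).sum_repr x]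
  refine Submodule.sum_mem _ fun i _ => ?_
  by_cases hi : x i = 0
  · simp [hi]
  · exact Submodule.smul_mem _ _ (Submodule.subset_span ⟨i, hx i hi, by simp⟩)

lemma finrank_coordSubspace_le (T : Finset (Fin L)) : finrank ℝ (coordSubspace T) ≤ T.card := by
  classical
  rw [coordSubspace, ← Finset.coe_image]
  exact (finrank_span_finset_le_card _).trans Finset.card_image_le

lemma sparseSphere_subset_biUnion_coordSubspace (S : ℕ) :
    sparseSphere S L ⊆ ⋃ T ∈ Finset.powersetCard (min S L) (Finset.univ : Finset (Fin L)),
      coordSubspace T ∩ closedBall 0 1 := by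
  classical
  rintro x ⟨hnorm, hsparse⟩
  have hcard : {i | x i ≠ 0}.toFinset.card ≤ min S L :=
    le_min ((Set.ncard_eq_toFinset_card' _).symm.trans_le hsparse) (card_finset_fin_le _)
  obtain ⟨T, hT, hTcard⟩ := Finset.exists_superset_card_eq hcard (by simp)
  exact Set.mem_biUnion (Finset.mem_powersetCard_univ.2 hTcard)
    ⟨mem_coordSubspace fun i hi => hT (by simpa using hi), mem_closedBall_zero_iff.2 hnorm.le⟩

lemma choose_mul_seventeen_pow_le (hL : 2 ≤ L) (S : ℕ) :
    L.choose (min S L) * 17 ^ min S L ≤ L ^ (6 * S) := by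
  have h17 : 17 ≤ L ^ 5 := calc
    17 ≤ 2 ^ 5 := by norm_num
    _ ≤ L ^ 5 := by gcongr
  calc L.choose (min S L) * 17 ^ min S L
      ≤ L ^ min S L * (L ^ 5) ^ min S L := by gcongr; exact Nat.choose_le_pow _ _
    _ = L ^ (6 * min S L) := by ring
    _ ≤ L ^ (6 * S) := by gcongr <;> omega

lemma exists_isQuadraticTestSet_sparseSphere_of_two_le (hL : 2 ≤ L) (S : ℕ) :
    ∃ A : Finset (EuclideanSpace ℝ (Fin L)), ↑A ⊆ closedBall (0 : EuclideanSpace ℝ (Fin L)) 1 ∧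
      A.card ≤ L ^ (6 * S) ∧ IsQuadraticTestSet ↑A (sparseSphere S L) := by
  classical
  choose A hball hcard htest using fun T : Finset (Fin L) =>
    exists_isQuadraticTestSet_submodule (coordSubspace T)
  refine ⟨(Finset.powersetCard (min S L) Finset.univ).biUnion A, ?_, ?_, ?_⟩
  · simpa using fun T _ => hball T
  · refine (Finset.card_biUnion_le_card_mul _ _ (17 ^ min S L) fun T hT => ?_).trans ?_
    · rw [← Finset.mem_powersetCard_univ.1 hT]
      exact (hcard T).trans (Nat.pow_le_pow_right (by norm_num) (finrank_coordSubspace_le T))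
    · simpa using choose_mul_seventeen_pow_le hL S
  · rw [Finset.coe_biUnion]
    exact (IsQuadraticTestSet.biUnion fun T _ => htest T).mono_right
      (sparseSphere_subset_biUnion_coordSubspace S)

lemma exists_isQuadraticTestSet_sparseSphere (hL : 0 < L) (S : ℕ) :
    ∃ A : Finset (EuclideanSpace ℝ (Fin L)), ↑A ⊆ closedBall (0 : EuclideanSpace ℝ (Fin L)) 1 ∧
      A.card ≤ L ^ (6 * S) ∧ IsQuadraticTestSet ↑A (sparseSphere S L) := by
  -- The bound `1 ^ (6 * S)` on the cardinality only leaves room for one test vector when `L = 1`.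
  obtain rfl | hL2 : L = 1 ∨ 2 ≤ L := by omega
  · refine ⟨{EuclideanSpace.single 0 1}, by simp, by simp, ?_⟩
    rw [Finset.coe_singleton]
    exact (isQuadraticTestSet_singleton_of_finrank_eq_one (by simp) (by simp)).mono_right
      fun x hx => mem_closedBall_zero_iff.2 hx.1.le
  · exact exists_isQuadraticTestSet_sparseSphere_of_two_le hL2 S

end SparseSphere

section SubGaussian

variable {Ω : Type*} [MeasurableSpace Ω] {P : Measure Ω}

lemma iIndepFun_curry {ι κ : Type*} [Countable ι] [Countable κ] {β : ι → κ → Type*}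
    [∀ i j, MeasurableSpace (β i j)] {X : (i : ι) → (j : κ) → Ω → β i j}
    (hX : ∀ i j, AEMeasurable (X i j) P) (h : iIndepFun (fun (p : ι × κ) ω => X p.1 p.2 ω) P) :
    iIndepFun (fun i ω j => X i j ω) P := by
  have := h.isProbabilityMeasure
  have hlaw : ∀ i j, IsProbabilityMeasure (P.map (X i j)) :=
    fun i j => Measure.isProbabilityMeasure_map (hX i j)
  have hrow : ∀ i, iIndepFun (X i) P := fun i =>
    h.precomp (g := fun j => (i, j)) (Prod.mk_right_injective i)
  have hsigma : iIndepFun (fun (p : (_ : ι) × κ) ω => X p.1 p.2 ω) P :=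
    h.precomp (Equiv.sigmaEquivProd ι κ).injective
  have hcurry : (fun ω i j => X i j ω) =
      MeasurableEquiv.piCurry β ∘ fun ω (p : (_ : ι) × κ) => X p.1 p.2 ω := by
    ext; simp [Sigma.curry]
  rw [iIndepFun_iff_map_fun_eq_infinitePi_map₀' fun i => aemeasurable_pi_lambda _ (hX i),
    hcurry, ← AEMeasurable.map_map_of_aemeasurable
      (MeasurableEquiv.piCurry β).measurable.aemeasurable
      (aemeasurable_pi_lambda (fun ω (p : (_ : ι) × κ) => X p.1 p.2 ω) fun p => hX p.1 p.2),
    (iIndepFun_iff_map_fun_eq_infinitePi_map₀' fun p => hX p.1 p.2).1 hsigma,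
    Measure.infinitePi_map_piCurry fun i j => P.map (X i j)]
  congr with i : 1
  rw [(iIndepFun_iff_map_fun_eq_infinitePi_map₀' (hX i)).1 (hrow i)]

lemma integral_eq_zero_of_hasSubgaussianMGF [IsProbabilityMeasure P] {X : Ω → ℝ} {c : ℝ≥0}
    (hX : HasSubgaussianMGF X c P) : ∫ ω, X ω ∂P = 0 := by
  have hmgf : HasDerivAt (mgf X P) (∫ ω, X ω ∂P) 0 := by
    simpa using hasDerivAt_mgf (t := 0) (by simp [hX.integrableExpSet_eq_univ])
  have hexp : HasDerivAt (fun t : ℝ => Real.exp (c * t ^ 2 / 2)) 0 0 := by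
    simpa using ((((hasDerivAt_id (0 : ℝ)).pow 2).const_mul (c : ℝ)).div_const 2).exp
  -- `exp (c t² / 2) - mgf X P t` is nonnegative and vanishes at `0`.
  have hmin : IsLocalMin (fun t => Real.exp (c * t ^ 2 / 2) - mgf X P t) 0 :=
    Filter.Eventually.of_forall fun t => by simpa using hX.mgf_le t
  simpa using hmin.hasDerivAt_eq_zero (hexp.sub hmgf)

lemma lintegral_exp_mul_gaussianReal (t : ℝ) :
    ∫⁻ g, ENNReal.ofReal (Real.exp (t * g)) ∂gaussianReal 0 1 =
      ENNReal.ofReal (Real.exp (t ^ 2 / 2)) := by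
  rw [← ofReal_integral_eq_lintegral_ofReal (integrable_exp_mul_gaussianReal t)
    (.of_forall fun _ => (Real.exp_pos _).le)]
  simpa [mgf] using congrArg ENNReal.ofReal (congrFun (mgf_id_gaussianReal (μ := 0) (v := 1)) t)

lemma gaussianPDF_mul_exp_sq_div_four (g : ℝ) :
    gaussianPDF 0 1 g * ENNReal.ofReal (Real.exp (g ^ 2 / 4)) =
      ENNReal.ofReal (√2) * gaussianPDF 0 2 g := by
  rw [gaussianPDF, gaussianPDF, ← ENNReal.ofReal_mul (gaussianPDFReal_nonneg _ _ _),
    ← ENNReal.ofReal_mul (by positivity), gaussianPDFReal, gaussianPDFReal, mul_assoc,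
    ← Real.exp_add]
  congr 1
  rw [mul_comm (2 * Real.pi) ((2 : ℝ≥0) : ℝ), NNReal.coe_ofNat, Real.sqrt_mul zero_le_two,
    mul_inv, ← mul_assoc, ← mul_assoc, mul_inv_cancel₀ (by positivity), one_mul, NNReal.coe_one,
    mul_one]
  congr 2
  ring

lemma lintegral_exp_sq_gaussianReal :
    ∫⁻ g, ENNReal.ofReal (Real.exp (g ^ 2 / 4)) ∂gaussianReal 0 1 = ENNReal.ofReal (√2) := by
  rw [gaussianReal_of_var_ne_zero _ one_ne_zero, lintegral_withDensity_eq_lintegral_mul _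
    (measurable_gaussianPDF _ _) (by fun_prop)]
  simp only [Pi.mul_apply, gaussianPDF_mul_exp_sq_div_four]
  rw [lintegral_const_mul _ (measurable_gaussianPDF _ _), lintegral_gaussianPDF_eq_one _
    two_ne_zero, mul_one]

/-- For `c = 0` the exponent is `0`, by the convention `x / 0 = 0`. -/
lemma lintegral_exp_sq_div_le [SFinite P] {X : Ω → ℝ} {c : ℝ≥0} (hX : HasSubgaussianMGF X c P) :
    ∫⁻ ω, ENNReal.ofReal (Real.exp (X ω ^ 2 / (4 * c))) ∂P ≤ 2 := by
  -- The moment generating function of a Gaussian linearises the square in the exponent.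
  have hlin : ∀ ω, ENNReal.ofReal (Real.exp (X ω ^ 2 / (4 * c))) =
      ∫⁻ g, ENNReal.ofReal (Real.exp (√(2 * c)⁻¹ * X ω * g)) ∂gaussianReal 0 1 := fun ω => by
    rw [lintegral_exp_mul_gaussianReal, mul_pow, Real.sq_sqrt (by positivity)]
    congr 2; ring
  have hmeas : AEMeasurable
      (fun p : Ω × ℝ => ENNReal.ofReal (Real.exp (√(2 * c)⁻¹ * X p.1 * p.2)))
      (P.prod (gaussianReal 0 1)) :=
    ((hX.aemeasurable.comp_fst.const_mul _).mul measurable_snd.aemeasurable).exp.ennreal_ofReal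
  have hmgf : ∀ g : ℝ, ∫⁻ ω, ENNReal.ofReal (Real.exp (√(2 * c)⁻¹ * X ω * g)) ∂P ≤
      ENNReal.ofReal (Real.exp (g ^ 2 / 4)) := fun g => by
    simp_rw [mul_right_comm _ (X _) g]
    rw [← ofReal_integral_eq_lintegral_ofReal (hX.integrable_exp_mul _)
      (.of_forall fun _ => (Real.exp_pos _).le)]
    refine ENNReal.ofReal_le_ofReal ((hX.mgf_le _).trans (Real.exp_le_exp.2 ?_))
    rw [mul_pow, Real.sq_sqrt (by positivity)]
    have hc : (c : ℝ) * (2 * (c : ℝ))⁻¹ ≤ 1 / 2 := by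
      rw [mul_inv, mul_left_comm]
      linarith [mul_inv_le_one (a := (c : ℝ))]
    nlinarith [mul_le_mul_of_nonneg_right hc (sq_nonneg g)]
  calc ∫⁻ ω, ENNReal.ofReal (Real.exp (X ω ^ 2 / (4 * c))) ∂P
      = ∫⁻ g, ∫⁻ ω, ENNReal.ofReal (Real.exp (√(2 * c)⁻¹ * X ω * g)) ∂P ∂gaussianReal 0 1 := by
        simp_rw [hlin]; exact lintegral_lintegral_swap hmeas
    _ ≤ ∫⁻ g, ENNReal.ofReal (Real.exp (g ^ 2 / 4)) ∂gaussianReal 0 1 := lintegral_mono hmgf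
    _ = ENNReal.ofReal (√2) := lintegral_exp_sq_gaussianReal
    _ ≤ 2 := by simp

variable {ι : Type*} [Fintype ι]

lemma exp_sum_sq_div_le {τ : ℝ} (hτ : 0 < τ) {c : ι → ℝ≥0} {x : ι → ℝ}
    (hcτ : ∑ n, (c n : ℝ) ≤ τ) (h0 : ∀ n, c n = 0 → x n = 0) :
    Real.exp ((∑ n, x n ^ 2) / (4 * τ)) ≤
      (1 - ∑ n, c n / τ) + ∑ n, c n / τ * Real.exp (x n ^ 2 / (4 * c n)) := by
  have hw : ∑ n, c n / τ ≤ 1 := by rw [← Finset.sum_div]; exact (div_le_one hτ).2 hcτ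
  have h := convexOn_exp.map_add_sum_le (t := Finset.univ) (w := fun n => c n / τ)
    (v := 1 - ∑ n, c n / τ) (q := 0) (p := fun n => x n ^ 2 / (4 * c n))
    (fun n _ => by positivity) (by simp) (fun _ _ => Set.mem_univ _) (sub_nonneg.2 hw)
    (Set.mem_univ _)
  simp only [smul_eq_mul, mul_zero, zero_add, Real.exp_zero, mul_one] at h
  refine le_of_eq_of_le ?_ h
  rw [Finset.sum_div]
  congr 2 with n
  rcases eq_or_ne (c n) 0 with hn | hn
  · simp [h0 n hn]
  · field_simp

lemma lintegral_exp_sum_sq_div_le [IsProbabilityMeasure P] {X : ι → Ω → ℝ} {c : ι → ℝ≥0}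
    (hX : ∀ n, HasSubgaussianMGF (X n) (c n) P) {τ : ℝ} (hτ : 0 < τ)
    (hcτ : ∑ n, (c n : ℝ) ≤ τ) :
    ∫⁻ ω, ENNReal.ofReal (Real.exp ((∑ n, X n ω ^ 2) / (4 * τ))) ∂P ≤ 2 := by
  have hw : ∑ n, c n / τ ≤ 1 := by rw [← Finset.sum_div]; exact (div_le_one hτ).2 hcτ
  have hzero : ∀ᵐ ω ∂P, ∀ n, c n = 0 → X n ω = 0 := ae_all_iff.2 fun n => by
    by_cases hn : c n = 0
    · filter_upwards [(hn ▸ hX n).ae_eq_zero_of_hasSubgaussianMGF_zero] with ω hω _ using hω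
    · exact .of_forall fun ω h => absurd h hn
  have hmeas : ∀ n, AEMeasurable (fun ω => ENNReal.ofReal (Real.exp (X n ω ^ 2 / (4 * c n)))) P :=
    fun n => (((hX n).aemeasurable.pow_const 2).div_const _).exp.ennreal_ofReal
  calc ∫⁻ ω, ENNReal.ofReal (Real.exp ((∑ n, X n ω ^ 2) / (4 * τ))) ∂P
      ≤ ∫⁻ ω, (ENNReal.ofReal (1 - ∑ n, c n / τ) +
          ∑ n, ENNReal.ofReal (c n / τ) *
            ENNReal.ofReal (Real.exp (X n ω ^ 2 / (4 * c n)))) ∂P := by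
        refine lintegral_mono_ae (hzero.mono fun ω hω => ?_)
        simp_rw [← ENNReal.ofReal_mul (div_nonneg (c _).coe_nonneg hτ.le)]
        rw [← ENNReal.ofReal_sum_of_nonneg fun n _ => by positivity,
          ← ENNReal.ofReal_add (sub_nonneg.2 hw) (Finset.sum_nonneg fun n _ => by positivity)]
        exact ENNReal.ofReal_le_ofReal (exp_sum_sq_div_le hτ hcτ hω)
    _ = ENNReal.ofReal (1 - ∑ n, c n / τ) + ∑ n, ENNReal.ofReal (c n / τ) *
          ∫⁻ ω, ENNReal.ofReal (Real.exp (X n ω ^ 2 / (4 * c n))) ∂P := by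
        rw [lintegral_add_left measurable_const, lintegral_const, measure_univ, mul_one,
          lintegral_finsetSum' _ fun n _ => (hmeas n).const_mul _]
        simp_rw [lintegral_const_mul'' _ (hmeas _)]
    _ ≤ ENNReal.ofReal (1 - ∑ n, c n / τ) * 2 + ∑ n, ENNReal.ofReal (c n / τ) * 2 := by
        gcongr with n
        · exact le_mul_of_one_le_right' one_le_two
        · exact lintegral_exp_sq_div_le (hX n)
    _ = 2 := by
        rw [← Finset.sum_mul, ← add_mul, ← ENNReal.ofReal_sum_of_nonneg fun n _ => by positivity,
          ← ENNReal.ofReal_add (sub_nonneg.2 hw) (by positivity), sub_add_cancel,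
          ENNReal.ofReal_one, one_mul]

end SubGaussian

section SubExponential

variable {Ω : Type*} [MeasurableSpace Ω] {P : Measure Ω}

/-- `Y` is sub-exponential with variance proxy `2 v` on the radius `r`: its moment generating
function is dominated by `exp (v l ^ 2)` for `|l| ≤ r`. This is what Bernstein's inequality uses. -/
structure HasSubexponentialMGF (Y : Ω → ℝ) (v r : ℝ) (P : Measure Ω) : Prop where
  integrable_exp_mul : ∀ l, |l| ≤ r → Integrable (fun ω => Real.exp (l * Y ω)) P
  mgf_le : ∀ l, |l| ≤ r → mgf Y P l ≤ Real.exp (v * l ^ 2)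

lemma HasSubexponentialMGF.neg {Y : Ω → ℝ} {v r : ℝ} (hY : HasSubexponentialMGF Y v r P) :
    HasSubexponentialMGF (-Y) v r P where
  integrable_exp_mul l hl := by simpa using hY.integrable_exp_mul (-l) (by rwa [abs_neg])
  mgf_le l hl := by
    rw [mgf_neg]
    simpa using hY.mgf_le (-l) (by rwa [abs_neg])

lemma HasSubexponentialMGF.sum {ι : Type*} [IsProbabilityMeasure P] {Y : ι → Ω → ℝ} {v : ι → ℝ}
    {r : ℝ} (hm : ∀ k, AEMeasurable (Y k) P) (hind : iIndepFun Y P) {s : Finset ι}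
    (hY : ∀ k ∈ s, HasSubexponentialMGF (Y k) (v k) r P) :
    HasSubexponentialMGF (∑ k ∈ s, Y k) (∑ k ∈ s, v k) r P where
  integrable_exp_mul l hl := by
    rw [← mgf_pos_iff, hind.mgf_sum₀ hm]
    exact Finset.prod_pos fun k hk => mgf_pos ((hY k hk).integrable_exp_mul l hl)
  mgf_le l hl := by
    rw [hind.mgf_sum₀ hm, Finset.sum_mul, Real.exp_sum]
    exact Finset.prod_le_prod (fun _ _ => mgf_nonneg) fun k hk => (hY k hk).mgf_le l hl

lemma HasSubexponentialMGF.measureReal_ge_le [IsFiniteMeasure P] {Y : Ω → ℝ} {v r ε : ℝ}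
    (hY : HasSubexponentialMGF Y v r P) (hv : 0 < v) (hr : 0 ≤ r) (hε : 0 ≤ ε) :
    P.real {ω | ε ≤ Y ω} ≤ Real.exp (-min (ε ^ 2 / (4 * v)) (r * ε / 2)) := by
  set l := min (ε / (2 * v)) r with hl
  have hl0 : 0 ≤ l := le_min (by positivity) hr
  have hlr : |l| ≤ r := (abs_of_nonneg hl0).trans_le (min_le_right _ _)
  have hvl : v * l ≤ ε / 2 := by
    calc v * l ≤ v * (ε / (2 * v)) := by gcongr; exact min_le_left _ _
      _ = ε / 2 := by field_simp
  have hmin : min (ε ^ 2 / (4 * v)) (r * ε / 2) = l * ε / 2 := by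
    rw [hl, min_mul_of_nonneg _ _ hε, ← min_div_div_right (zero_le_two (α := ℝ))]
    congr 1
    field_simp
    ring
  calc P.real {ω | ε ≤ Y ω} ≤ Real.exp (-l * ε) * mgf Y P l :=
        measure_ge_le_exp_mul_mgf ε hl0 (hY.integrable_exp_mul l hlr)
    _ ≤ Real.exp (-l * ε) * Real.exp (v * l ^ 2) := by gcongr; exact hY.mgf_le l hlr
    _ ≤ Real.exp (-min (ε ^ 2 / (4 * v)) (r * ε / 2)) := by
        rw [← Real.exp_add, Real.exp_le_exp, hmin]
        nlinarith

lemma HasSubexponentialMGF.measureReal_abs_ge_le [IsFiniteMeasure P] {Y : Ω → ℝ} {v r ε : ℝ}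
    (hY : HasSubexponentialMGF Y v r P) (hv : 0 < v) (hr : 0 ≤ r) (hε : 0 ≤ ε) :
    P.real {ω | ε ≤ |Y ω|} ≤ 2 * Real.exp (-min (ε ^ 2 / (4 * v)) (r * ε / 2)) := by
  have hunion : {ω | ε ≤ |Y ω|} = {ω | ε ≤ Y ω} ∪ {ω | ε ≤ (-Y) ω} := by
    ext ω; simp only [Set.mem_ofPred_eq, le_abs, Set.mem_union, Pi.neg_apply]
  rw [hunion, two_mul]
  exact (measureReal_union_le _ _).trans (add_le_add (hY.measureReal_ge_le hv hr hε)
    (hY.neg.measureReal_ge_le hv hr hε))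

lemma exp_le_one_add_add_sq_mul_exp_abs (y : ℝ) :
    Real.exp y ≤ 1 + y + y ^ 2 * Real.exp |y| := by
  have h := Complex.norm_exp_sub_sum_le_norm_mul_exp (y : ℂ) 2
  have hcast : Complex.exp (y : ℂ) - ∑ m ∈ Finset.range 2, (y : ℂ) ^ m / m.factorial =
      ((Real.exp y - (1 + y) : ℝ) : ℂ) := by
    simp [Finset.sum_range_succ]
  rw [hcast, Complex.norm_real, Complex.norm_real, Real.norm_eq_abs, Real.norm_eq_abs, sq_abs] at h
  linarith [le_abs_self (Real.exp y - (1 + y))]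

lemma exp_mul_le_one_add_add_sq_mul {s l : ℝ} (hs : 0 < s) (hl : |l| ≤ s / 2) (y : ℝ) :
    Real.exp (l * y) ≤ 1 + l * y + l ^ 2 * (8 / s ^ 2 * Real.exp (s * |y|)) := by
  have hly : |l * y| ≤ s * |y| / 2 := by
    rw [abs_mul, mul_div_right_comm]
    gcongr
  have hy : y ^ 2 ≤ 8 / s ^ 2 * Real.exp (s * |y| / 2) := by
    have h := Real.quadratic_le_exp_of_nonneg (x := s * |y| / 2) (by positivity)
    rw [div_mul_eq_mul_div, le_div_iff₀ (by positivity), ← sq_abs y]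
    nlinarith [mul_nonneg hs.le (abs_nonneg y)]
  calc Real.exp (l * y) ≤ 1 + l * y + (l * y) ^ 2 * Real.exp |l * y| :=
        exp_le_one_add_add_sq_mul_exp_abs _
    _ ≤ 1 + l * y + l ^ 2 * (8 / s ^ 2 * Real.exp (s * |y| / 2)) * Real.exp (s * |y| / 2) := by
        rw [mul_pow]; gcongr
    _ = 1 + l * y + l ^ 2 * (8 / s ^ 2 * Real.exp (s * |y|)) := by
        rw [mul_assoc, mul_assoc, ← Real.exp_add, add_halves]

lemma integrable_of_integrable_exp_mul_abs {Y : Ω → ℝ} (hm : AEMeasurable Y P) {s : ℝ}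
    (hs : 0 < s) (hi : Integrable (fun ω => Real.exp (s * |Y ω|)) P) : Integrable Y P := by
  refine (hi.const_mul s⁻¹).mono' hm.aestronglyMeasurable (.of_forall fun ω => ?_)
  rw [Real.norm_eq_abs, le_inv_mul_iff₀ hs]
  linarith [Real.add_one_le_exp (s * |Y ω|)]

lemma hasSubexponentialMGF_of_integral_exp_mul_abs_le [IsProbabilityMeasure P] {Y : Ω → ℝ}
    (hm : AEMeasurable Y P) {s M : ℝ} (hs : 0 < s)
    (hi : Integrable (fun ω => Real.exp (s * |Y ω|)) P)
    (hM : ∫ ω, Real.exp (s * |Y ω|) ∂P ≤ M) (hmean : ∫ ω, Y ω ∂P = 0) :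
    HasSubexponentialMGF Y (8 / s ^ 2 * M) (s / 2) P := by
  have hint : ∀ l, |l| ≤ s / 2 → Integrable (fun ω => Real.exp (l * Y ω)) P := fun l hl => by
    refine hi.mono' (hm.const_mul l).exp.aestronglyMeasurable (.of_forall fun ω => ?_)
    rw [Real.norm_of_nonneg (Real.exp_pos _).le, Real.exp_le_exp]
    refine (le_abs_self _).trans ?_
    rw [abs_mul]
    gcongr
    linarith
  refine ⟨hint, fun l hl => ?_⟩
  have hlin : Integrable (fun ω => 1 + l * Y ω) P :=
    (integrable_const 1).add ((integrable_of_integrable_exp_mul_abs hm hs hi).const_mul l)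
  have hquad : Integrable (fun ω => l ^ 2 * (8 / s ^ 2 * Real.exp (s * |Y ω|))) P :=
    (hi.const_mul _).const_mul _
  calc mgf Y P l
      ≤ ∫ ω, (1 + l * Y ω + l ^ 2 * (8 / s ^ 2 * Real.exp (s * |Y ω|))) ∂P :=
        integral_mono (hint l hl) (hlin.add hquad) fun ω => exp_mul_le_one_add_add_sq_mul hs hl _
    _ = l ^ 2 * (8 / s ^ 2 * ∫ ω, Real.exp (s * |Y ω|) ∂P) + 1 := by
        rw [integral_add hlin hquad, integral_add (integrable_const 1)
          ((integrable_of_integrable_exp_mul_abs hm hs hi).const_mul l), integral_const_mul, hmean,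
          integral_const_mul, integral_const_mul]
        simp [add_comm]
    _ ≤ l ^ 2 * (8 / s ^ 2 * M) + 1 := by gcongr
    _ ≤ Real.exp (8 / s ^ 2 * M * l ^ 2) := by
        rw [mul_comm (8 / s ^ 2 * M)]; exact Real.add_one_le_exp _

lemma hasSubexponentialMGF_sub_integral [IsProbabilityMeasure P] {W : Ω → ℝ}
    (hm : AEMeasurable W P) {s M : ℝ} (hs : 0 < s)
    (hi : Integrable (fun ω => Real.exp (s * |W ω|)) P)
    (hM : ∫ ω, Real.exp (s * |W ω|) ∂P ≤ M) :
    HasSubexponentialMGF (fun ω => W ω - ∫ ω', W ω' ∂P) (8 / s ^ 2 * M ^ 2) (s / 2) P := by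
  have hW := integrable_of_integrable_exp_mul_abs hm hs hi
  set m := ∫ ω, W ω ∂P with hmdef
  have hjensen : Real.exp (s * |m|) ≤ M := by
    refine le_trans (Real.exp_le_exp.2 ?_) ((convexOn_exp.map_integral_le
      Real.continuous_exp.continuousOn isClosed_univ (by simp) (hW.abs.const_mul s) hi).trans hM)
    rw [integral_const_mul]
    gcongr
    exact abs_integral_le_integral_abs
  have hpt : ∀ ω, Real.exp (s * |W ω - m|) ≤ Real.exp (s * |m|) * Real.exp (s * |W ω|) :=
    fun ω => by
      rw [← Real.exp_add, Real.exp_le_exp, ← mul_add]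
      gcongr
      linarith [abs_sub (W ω) m]
  have hYm : AEMeasurable (fun ω => W ω - m) P := hm.sub_const m
  have hYi : Integrable (fun ω => Real.exp (s * |W ω - m|)) P := by
    refine (hi.const_mul (Real.exp (s * |m|))).mono'
      (hYm.abs.const_mul s).exp.aestronglyMeasurable (.of_forall fun ω => ?_)
    rw [Real.norm_of_nonneg (Real.exp_pos _).le]
    exact hpt ω
  refine hasSubexponentialMGF_of_integral_exp_mul_abs_le hYm hs hYi ?_ ?_
  · calc ∫ ω, Real.exp (s * |W ω - m|) ∂P
        ≤ ∫ ω, Real.exp (s * |m|) * Real.exp (s * |W ω|) ∂P :=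
          integral_mono hYi (hi.const_mul _) hpt
      _ = Real.exp (s * |m|) * ∫ ω, Real.exp (s * |W ω|) ∂P := integral_const_mul _ _
      _ ≤ M * M := by gcongr; exact (Real.exp_pos _).le.trans hjensen
      _ = M ^ 2 := (sq M).symm
  · rw [integral_sub hW (integrable_const m), integral_const, probReal_univ, one_smul, ← hmdef,
      sub_self]

lemma hasSubexponentialMGF_sum_sq_sub_integral {ι : Type*} [Fintype ι] [IsProbabilityMeasure P]
    {X : ι → Ω → ℝ} {c : ι → ℝ≥0} (hX : ∀ n, HasSubgaussianMGF (X n) (c n) P) {τ : ℝ}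
    (hτ : 0 < τ) (hcτ : ∑ n, (c n : ℝ) ≤ τ) :
    HasSubexponentialMGF (fun ω => ∑ n, X n ω ^ 2 - ∫ ω', ∑ n, X n ω' ^ 2 ∂P)
      (512 * τ ^ 2) (1 / (8 * τ)) P := by
  have hm : AEMeasurable (fun ω => ∑ n, X n ω ^ 2) P :=
    Finset.aemeasurable_fun_sum _ fun n _ => (hX n).aemeasurable.pow_const 2
  have habs : ∀ ω, (4 * τ)⁻¹ * |∑ n, X n ω ^ 2| = (∑ n, X n ω ^ 2) / (4 * τ) := fun ω => by
    rw [abs_of_nonneg (Finset.sum_nonneg fun n _ => sq_nonneg _), inv_mul_eq_div]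
  have hle := lintegral_exp_sum_sq_div_le hX hτ hcτ
  have hi : Integrable (fun ω => Real.exp ((∑ n, X n ω ^ 2) / (4 * τ))) P :=
    (lintegral_ofReal_ne_top_iff_integrable (hm.div_const _).exp.aestronglyMeasurable
      (.of_forall fun _ => (Real.exp_pos _).le)).1 (ne_top_of_le_ne_top (by simp) hle)
  have hM : ∫ ω, Real.exp ((∑ n, X n ω ^ 2) / (4 * τ)) ∂P ≤ 2 := by
    rw [← ofReal_integral_eq_lintegral_ofReal hi (.of_forall fun _ => (Real.exp_pos _).le)] at hle
    exact (ENNReal.ofReal_le_ofNat).1 hle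
  have h := hasSubexponentialMGF_sub_integral hm (s := (4 * τ)⁻¹) (M := 2) (by positivity)
    (by simpa only [habs] using hi) (by simpa only [habs] using hM)
  convert! h using 1
  · field_simp; norm_num
  · field_simp; norm_num

end SubExponential

section Chaos

variable {Ω ι κ ν : Type*} [Fintype ι] [Fintype κ] [Fintype ν] [MeasurableSpace Ω]
  {P : Measure Ω}

section Block

variable {ξ : ι → Ω → ℝ} {c : ι → ℝ≥0}

lemma hasSubgaussianMGF_sum_mul (hξ : ∀ i, HasSubgaussianMGF (ξ i) (c i) P) (hind : iIndepFun ξ P)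
    (a : ι → ℝ) :
    HasSubgaussianMGF (fun ω => ∑ i, a i * ξ i ω) (∑ i, ‖a i‖₊ ^ 2 * c i) P := by
  refine HasSubgaussianMGF.sum_of_iIndepFun
    (hind.comp (fun i x => a i * x) fun i => by fun_prop) fun i _ => ?_
  have hsq : ‖a i‖₊ ^ 2 = ⟨a i ^ 2, sq_nonneg _⟩ := NNReal.eq (sq_abs (a i))
  rw [hsq]
  exact (hξ i).const_mul (a i)

variable [IsProbabilityMeasure P]

lemma integral_sq_sum_mul (hξ : ∀ i, HasSubgaussianMGF (ξ i) (c i) P) (hind : iIndepFun ξ P)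
    (a : ι → ℝ) :
    ∫ ω, (∑ i, a i * ξ i ω) ^ 2 ∂P = ∑ i, a i ^ 2 * Var[ξ i; P] := by
  have hsub := hasSubgaussianMGF_sum_mul hξ hind a
  have hind' : iIndepFun (fun i ω => a i * ξ i ω) P :=
    hind.comp (fun i x => a i * x) fun i => by fun_prop
  rw [← variance_of_integral_eq_zero hsub.aemeasurable
    (integral_eq_zero_of_hasSubgaussianMGF hsub), ← Finset.sum_fn,
    IndepFun.variance_sum (fun i _ => ((hξ i).memLp 2).const_mul (a i))
      fun i _ j _ hij => hind'.indepFun hij]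
  simp_rw [variance_const_mul]

lemma integral_sum_sq_sum_mul (hξ : ∀ i, HasSubgaussianMGF (ξ i) (c i) P)
    (hind : iIndepFun ξ P) (b : ν → ι → ℝ) :
    ∫ ω, ∑ n, (∑ i, b n i * ξ i ω) ^ 2 ∂P = ∑ n, ∑ i, b n i ^ 2 * Var[ξ i; P] := by
  rw [integral_finsetSum _ fun n _ =>
    ((hasSubgaussianMGF_sum_mul hξ hind (b n)).memLp 2).integrable_sq]
  simp_rw [integral_sq_sum_mul hξ hind]

end Block

variable [IsProbabilityMeasure P] {φ : κ → ι → Ω → ℝ} {c : ι → ℝ≥0}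

lemma hasSubexponentialMGF_sum_chaos_sub_integral
    (hφ : ∀ k i, HasSubgaussianMGF (φ k i) (c i) P)
    (hind : iIndepFun (fun p : κ × ι => φ p.1 p.2) P) (b : ν → ι → ℝ) {τ : ℝ} (hτ : 0 < τ)
    (hb : ∑ n, ∑ i, b n i ^ 2 * c i ≤ τ) :
    HasSubexponentialMGF
      (fun ω => ∑ k, (∑ n, (∑ i, b n i * φ k i ω) ^ 2 - ∑ n, ∑ i, b n i ^ 2 * Var[φ k i; P]))
      (Fintype.card κ * (512 * τ ^ 2)) (1 / (8 * τ)) P := by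
  have hrow : ∀ k, iIndepFun (φ k) P := fun k =>
    hind.precomp (g := fun i => (k, i)) (Prod.mk_right_injective k)
  have hm : ∀ k i, AEMeasurable (φ k i) P := fun k i => (hφ k i).aemeasurable
  have hblocks := (iIndepFun_curry hm hind).comp
    (fun k x => ∑ n, (∑ i, b n i * x i) ^ 2 - ∑ n, ∑ i, b n i ^ 2 * Var[φ k i; P])
    fun k => by fun_prop
  have hsum := HasSubexponentialMGF.sum (s := Finset.univ) (v := fun _ => 512 * τ ^ 2)
    (r := 1 / (8 * τ)) (fun k => ?_) hblocks fun k _ => ?_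
  · simpa [Function.comp_def, Finset.sum_fn] using hsum
  · exact (Finset.aemeasurable_fun_sum _ fun n _ => (Finset.aemeasurable_fun_sum _ fun i _ =>
      (hm k i).const_mul _).pow_const 2).sub_const _
  · have h := hasSubexponentialMGF_sum_sq_sub_integral
      (fun n => hasSubgaussianMGF_sum_mul (hφ k) (hrow k) (b n)) hτ (by simpa using hb)
    rwa [integral_sum_sq_sum_mul (hφ k) (hrow k)] at h

end Chaos

section Rademacher

variable {Ω : Type*} [MeasurableSpace Ω] {P : Measure Ω} {ξ : Ω → ℝ}

lemma integral_rademacher (f : ℝ → ℝ) : ∫ x, f x ∂rademacher = (f 1 + f (-1)) / 2 := by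
  have hint : ∀ a : ℝ, Integrable f ((2⁻¹ : ℝ≥0∞) • Measure.dirac a) := fun a =>
    (integrable_dirac (by simp)).smul_measure (by simp)
  rw [rademacher, integral_add_measure (hint 1) (hint (-1)), integral_smul_measure,
    integral_smul_measure, integral_dirac, integral_dirac]
  simp only [ENNReal.toReal_inv, ENNReal.toReal_ofNat, smul_eq_mul]
  ring

lemma integral_comp_eq_of_hasLaw_rademacher (h : HasLaw ξ rademacher P) {f : ℝ → ℝ}
    (hf : Measurable f) : ∫ ω, f (ξ ω) ∂P = (f 1 + f (-1)) / 2 := by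
  rw [← integral_rademacher, ← h.integral_comp hf.aestronglyMeasurable, Function.comp_def]

lemma integral_eq_zero_of_hasLaw_rademacher (h : HasLaw ξ rademacher P) : ∫ ω, ξ ω ∂P = 0 := by
  simpa using integral_comp_eq_of_hasLaw_rademacher h measurable_id

lemma variance_eq_one_of_hasLaw_rademacher [IsProbabilityMeasure P]
    (h : HasLaw ξ rademacher P) : Var[ξ; P] = 1 := by
  rw [variance_of_integral_eq_zero h.aemeasurable (integral_eq_zero_of_hasLaw_rademacher h)]
  refine (integral_comp_eq_of_hasLaw_rademacher h (measurable_id.pow_const 2)).trans ?_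
  norm_num

lemma ae_rademacher_mem_Icc : ∀ᵐ x ∂rademacher, x ∈ Set.Icc (-1 : ℝ) 1 := by
  rw [rademacher, ae_add_measure_iff]
  constructor <;> refine Measure.ae_smul_measure ?_ _ <;> simp [ae_dirac_eq]

lemma hasSubgaussianMGF_of_hasLaw_rademacher [IsProbabilityMeasure P]
    (h : HasLaw ξ rademacher P) :
    HasSubgaussianMGF ξ 1 P := by
  have hmem : ∀ᵐ ω ∂P, ξ ω ∈ Set.Icc (-1 : ℝ) 1 :=
    (h.ae_iff (measurable_mem.2 measurableSet_Icc)).2 ae_rademacher_mem_Icc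
  have hwidth : (‖(1 : ℝ) - -1‖₊ / 2) ^ 2 = 1 := by
    rw [← NNReal.coe_inj]; norm_num
  have hsub := hasSubgaussianMGF_of_mem_Icc h.aemeasurable hmem
  simpa only [hwidth, integral_eq_zero_of_hasLaw_rademacher h, sub_zero] using hsub

end Rademacher

section Columns

variable {N L K : ℕ} (G : Matrix (Fin N) (Fin L) ℝ)

lemma colNorm_sq (i : Fin L) : colNorm G i ^ 2 = ∑ n, G n i ^ 2 := by
  rw [colNorm, EuclideanSpace.norm_sq_eq]
  simp [Matrix.toLpLin_apply]

lemma colNorm_le_thetaMax (i : Fin L) : colNorm G i ≤ thetaMax G :=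
  le_ciSup (Set.finite_range _).bddAbove i

lemma thetaMin_le_colNorm (i : Fin L) : thetaMin G ≤ colNorm G i :=
  ciInf_le (Set.finite_range _).bddBelow i

lemma sum_colNorm_sq_mul_sq_le (x : EuclideanSpace ℝ (Fin L)) :
    ∑ i, colNorm G i ^ 2 * x i ^ 2 ≤ thetaMax G ^ 2 * ‖x‖ ^ 2 := by
  rw [EuclideanSpace.real_norm_sq_eq, Finset.mul_sum]
  gcongr with i
  · exact norm_nonneg _
  · exact colNorm_le_thetaMax G i

variable {G}

lemma thetaMin_sq_mul_norm_sq_le (hG : 0 ≤ thetaMin G) (x : EuclideanSpace ℝ (Fin L)) :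
    thetaMin G ^ 2 * ‖x‖ ^ 2 ≤ ∑ i, colNorm G i ^ 2 * x i ^ 2 := by
  rw [EuclideanSpace.real_norm_sq_eq, Finset.mul_sum]
  gcongr with i
  exact thetaMin_le_colNorm G i

lemma pos_of_thetaMin_pos (hG : 0 < thetaMin G) : 0 < L := by
  rcases L.eq_zero_or_pos with rfl | hL
  · simp [thetaMin] at hG
  · exact hL

lemma thetaMin_le_thetaMax (hG : 0 < thetaMin G) : thetaMin G ≤ thetaMax G :=
  let i : Fin L := ⟨0, pos_of_thetaMin_pos hG⟩
  (thetaMin_le_colNorm G i).trans (colNorm_le_thetaMax G i)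

lemma one_le_condRatio (hG : 0 < thetaMin G) : 1 ≤ condRatio G := by
  rw [condRatio, one_le_div (by positivity)]
  gcongr
  exact thetaMin_le_thetaMax hG

end Columns

section Energy

variable {N L K S : ℕ}

/-- The deviation `‖H x‖² - K ∑ᵢ ‖G eᵢ‖² xᵢ²` of the energy of the measurements from its mean under
independent masks with centred entries of unit variance, as a quadratic form in the signal `x`. -/
noncomputable def energyDeviation (G : Matrix (Fin N) (Fin L) ℝ) (φ : Fin K → Fin L → ℝ) :
    QuadraticForm ℝ (EuclideanSpace ℝ (Fin L)) :=
  (LinearMap.BilinMap.toQuadraticMap (innerₗ _)).comp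
      (Matrix.toEuclideanLin (measurementMatrix G φ)) -
    (QuadraticMap.weightedSumSquares ℝ fun i => K * colNorm G i ^ 2).comp
      (WithLp.linearEquiv 2 ℝ (Fin L → ℝ)).toLinearMap

lemma energyDeviation_apply (G : Matrix (Fin N) (Fin L) ℝ) (φ : Fin K → Fin L → ℝ)
    (x : EuclideanSpace ℝ (Fin L)) :
    energyDeviation G φ x = ‖Matrix.toEuclideanLin (measurementMatrix G φ) x‖ ^ 2 -
      K * ∑ i, colNorm G i ^ 2 * x i ^ 2 := by
  simp [energyDeviation, QuadraticMap.weightedSumSquares_apply, Finset.mul_sum, sq, mul_assoc]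

lemma norm_sq_measurementMatrix (G : Matrix (Fin N) (Fin L) ℝ) (φ : Fin K → Fin L → ℝ)
    (x : EuclideanSpace ℝ (Fin L)) :
    ‖Matrix.toEuclideanLin (measurementMatrix G φ) x‖ ^ 2 =
      ∑ k, ∑ n, (∑ i, G n i * x i * φ k i) ^ 2 := by
  rw [EuclideanSpace.real_norm_sq_eq, Fintype.sum_prod_type]
  simp only [Matrix.toLpLin_apply, measurementMatrix, Matrix.mulVec, dotProduct,
    Matrix.of_apply, Matrix.mul_diagonal, mul_right_comm]

lemma sum_colNorm_sq_mul_sq (G : Matrix (Fin N) (Fin L) ℝ) (x : EuclideanSpace ℝ (Fin L)) :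
    ∑ i, colNorm G i ^ 2 * x i ^ 2 = ∑ n, ∑ i, (G n i * x i) ^ 2 := by
  rw [Finset.sum_comm]
  simp_rw [colNorm_sq, Finset.sum_mul, mul_pow]

lemma hasRIP_of_forall_sparseSphere {ι : Type*} [Fintype ι] {A : Matrix ι (Fin L) ℝ} {ε : ℝ}
    (h0 : 0 < ε) (h1 : ε < 1)
    (h : ∀ x ∈ sparseSphere S L, |‖Matrix.toEuclideanLin A x‖ ^ 2 - 1| ≤ ε) :
    HasRIP A S ε := by
  refine ⟨h0, h1, fun x hx => ?_⟩
  rcases eq_or_ne x 0 with rfl | hx0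
  · simp
  have hunit : ‖x‖⁻¹ • x ∈ sparseSphere S L :=
    ⟨norm_smul_inv_norm hx0, by simpa [IsSparse, hx0] using hx⟩
  have hscale : ‖Matrix.toEuclideanLin A (‖x‖⁻¹ • x)‖ ^ 2 =
      ‖Matrix.toEuclideanLin A x‖ ^ 2 / ‖x‖ ^ 2 := by
    rw [map_smul, norm_smul, norm_inv, norm_norm, mul_pow, inv_pow, div_eq_inv_mul]
  have hpos : 0 < ‖x‖ ^ 2 := by positivity
  obtain ⟨hlower, hupper⟩ := abs_sub_le_iff.1 (hscale ▸ h _ hunit)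
  exact ⟨(le_div_iff₀ hpos).1 (by linarith), (div_le_iff₀ hpos).1 (by linarith)⟩

lemma abs_div_sub_one_le {a b e k z δ : ℝ} (hk : 0 < k) (hb : 0 < b) (hbe : b ≤ e) (hea : e ≤ a)
    (hz : |z - k * e| ≤ k * δ * b) :
    |z / (k * ((a + b) / 2)) - 1| ≤ (a / b - 1 + 2 * δ) / (a / b + 1) := by
  have ha : 0 < a := hb.trans_le (hbe.trans hea)
  have hlhs : z / (k * ((a + b) / 2)) - 1 =
      (2 * (z - k * e) + k * (2 * e - (a + b))) / (k * (a + b)) := by field_simp; ring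
  have hrhs : (a / b - 1 + 2 * δ) / (a / b + 1) =
      (2 * (k * δ * b) + k * (a - b)) / (k * (a + b)) := by field_simp; ring
  have hmid : |2 * e - (a + b)| ≤ a - b := abs_le.2 ⟨by linarith, by linarith⟩
  rw [hlhs, hrhs, abs_div, abs_of_pos (a := k * (a + b)) (by positivity)]
  gcongr
  calc |2 * (z - k * e) + k * (2 * e - (a + b))|
      ≤ |2 * (z - k * e)| + |k * (2 * e - (a + b))| := abs_add_le _ _
    _ = 2 * |z - k * e| + k * |2 * e - (a + b)| := by
      rw [abs_mul, abs_mul, abs_two, abs_of_pos hk]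
    _ ≤ 2 * (k * δ * b) + k * (a - b) := by gcongr

variable {G : Matrix (Fin N) (Fin L) ℝ} {φ : Fin K → Fin L → ℝ} {δ : ℝ}

lemma abs_norm_sq_div_sub_one_le_of_abs_energyDeviation_le (hG : 0 < thetaMin G) (hK : 0 < K)
    {x : EuclideanSpace ℝ (Fin L)} (hx : ‖x‖ = 1)
    (h : |energyDeviation G φ x| ≤ K * δ * thetaMin G ^ 2) :
    |‖Matrix.toEuclideanLin (measurementMatrix G φ) x‖ ^ 2 / (K * thetaAvgSq G) - 1| ≤
      (condRatio G - 1 + 2 * δ) / (condRatio G + 1) := by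
  rw [energyDeviation_apply] at h
  exact abs_div_sub_one_le (by positivity) (by positivity)
    (by simpa [hx] using thetaMin_sq_mul_norm_sq_le hG.le x)
    (by simpa [hx] using sum_colNorm_sq_mul_sq_le G x) h

lemma hasRIP_of_abs_norm_sq_div_sub_one_le (hG : 0 < thetaMin G) (hδ0 : 0 < δ) (hδ1 : δ < 1)
    (h : ∀ x ∈ sparseSphere S L,
      |‖Matrix.toEuclideanLin (measurementMatrix G φ) x‖ ^ 2 / (K * thetaAvgSq G) - 1| ≤
        (condRatio G - 1 + 2 * δ) / (condRatio G + 1)) :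
    HasRIP ((√(K * thetaAvgSq G))⁻¹ • measurementMatrix G φ) S
      ((condRatio G - 1 + 2 * δ) / (condRatio G + 1)) := by
  have hμ := one_le_condRatio hG
  refine hasRIP_of_forall_sparseSphere (div_pos (by linarith) (by linarith))
    ((div_lt_one (by linarith)).2 (by linarith)) fun x hx => ?_
  have hpos : 0 ≤ K * thetaAvgSq G := by rw [thetaAvgSq]; positivity
  rw [map_smul, LinearMap.smul_apply, norm_smul, norm_inv, Real.norm_of_nonneg (Real.sqrt_nonneg _),
    mul_pow, inv_pow, Real.sq_sqrt hpos, ← div_eq_inv_mul]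
  exact h x hx

end Energy

section UniformDeviation

variable {Ω : Type*} [MeasurableSpace Ω] {P : Measure Ω}

lemma IsQuadraticTestSet.measureReal_exists_lt_le {E : Type*} [AddCommGroup E] [Module ℝ E]
    [IsFiniteMeasure P] {A : Finset E} {B : Set E} (hAB : IsQuadraticTestSet (A : Set E) B)
    (q : Ω → QuadraticForm ℝ E) {η p : ℝ} (hp : ∀ y ∈ A, P.real {ω | η ≤ |q ω y|} ≤ p) :
    P.real {ω | ∃ x ∈ B, 2 * η < |q ω x|} ≤ A.card * p := by
  have hsub : {ω | ∃ x ∈ B, 2 * η < |q ω x|} ⊆ ⋃ y ∈ A, {ω | η ≤ |q ω y|} := by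
    rintro ω ⟨x, hx, hlt⟩
    by_contra hω
    simp only [Set.mem_iUnion, Set.mem_ofPred_eq, exists_prop, not_exists, not_and, not_le] at hω
    exact hlt.not_ge (hAB (q ω) η (fun y hy => (hω y hy).le) x hx)
  calc P.real {ω | ∃ x ∈ B, 2 * η < |q ω x|}
      ≤ P.real (⋃ y ∈ A, {ω | η ≤ |q ω y|}) := measureReal_mono hsub (measure_ne_top P _)
    _ ≤ ∑ y ∈ A, P.real {ω | η ≤ |q ω y|} := measureReal_biUnion_finset_le _ _
    _ ≤ A.card • p := Finset.sum_le_card_nsmul _ _ _ hp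
    _ = A.card * p := nsmul_eq_mul _ _

variable [IsProbabilityMeasure P] {N L K : ℕ} {G : Matrix (Fin N) (Fin L) ℝ}
  {φ : Fin K → Fin L → Ω → ℝ} {κ : ℝ≥0} {t : ℝ}

lemma hasSubexponentialMGF_energyDeviation (hφ : ∀ k i, HasSubgaussianMGF (φ k i) κ P)
    (hvar : ∀ k i, Var[φ k i; P] = 1) (hind : iIndepFun (fun p : Fin K × Fin L => φ p.1 p.2) P)
    (hmax : 0 < thetaMax G) {y : EuclideanSpace ℝ (Fin L)} (hy : ‖y‖ ≤ 1) :
    HasSubexponentialMGF (fun ω => energyDeviation G (fun k i => φ k i ω) y)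
      (K * (512 * ((κ + 1) * thetaMax G ^ 2) ^ 2)) (1 / (8 * ((κ + 1) * thetaMax G ^ 2))) P := by
  have henergy : ∑ n, ∑ i, (G n i * y i) ^ 2 ≤ thetaMax G ^ 2 := by
    rw [← sum_colNorm_sq_mul_sq]
    exact (sum_colNorm_sq_mul_sq_le G y).trans
      (mul_le_of_le_one_right (by positivity) (pow_le_one₀ (norm_nonneg _) hy))
  have hproxy : ∑ n, ∑ i, (G n i * y i) ^ 2 * (κ : ℝ) ≤ (κ + 1) * thetaMax G ^ 2 := by
    simp_rw [← Finset.sum_mul]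
    rw [mul_comm]
    gcongr
    linarith
  have hchaos := hasSubexponentialMGF_sum_chaos_sub_integral hφ hind (fun n i => G n i * y i)
    (by positivity) hproxy
  simpa only [energyDeviation_apply, norm_sq_measurementMatrix, sum_colNorm_sq_mul_sq, hvar,
    mul_one, Finset.sum_sub_distrib, Finset.sum_const, Finset.card_univ, Fintype.card_fin,
    nsmul_eq_mul] using hchaos

lemma measureReal_abs_energyDeviation_ge_le (hφ : ∀ k i, HasSubgaussianMGF (φ k i) κ P)
    (hvar : ∀ k i, Var[φ k i; P] = 1) (hind : iIndepFun (fun p : Fin K × Fin L => φ p.1 p.2) P)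
    (hmax : 0 < thetaMax G) (hK : 0 < K) (ht0 : 0 ≤ t) (ht1 : t ≤ 1)
    {y : EuclideanSpace ℝ (Fin L)} (hy : ‖y‖ ≤ 1) :
    P.real {ω | K * t * thetaMax G ^ 2 ≤ |energyDeviation G (fun k i => φ k i ω) y|} ≤
      2 * Real.exp (-(K * t ^ 2 / (2048 * (κ + 1) ^ 2))) := by
  refine ((hasSubexponentialMGF_energyDeviation hφ hvar hind hmax hy).measureReal_abs_ge_le
    (by positivity) (by positivity) (by positivity)).trans ?_
  gcongr
  refine le_min (le_of_eq ?_) ?_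
  · field_simp
    ring
  · have hlin : 1 / (8 * ((κ + 1) * thetaMax G ^ 2)) * (K * t * thetaMax G ^ 2) / 2 =
        K * t / (16 * (κ + 1)) := by field_simp; ring
    have hκ : (1 : ℝ) ≤ κ + 1 := le_add_of_nonneg_left κ.coe_nonneg
    rw [hlin]
    gcongr
    · exact pow_le_of_le_one ht0 ht1 two_ne_zero
    · norm_num
    · exact le_self_pow₀ hκ two_ne_zero

lemma measureReal_exists_sparseSphere_energyDeviation_gt_le
    (hφ : ∀ k i, HasSubgaussianMGF (φ k i) κ P) (hvar : ∀ k i, Var[φ k i; P] = 1)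
    (hind : iIndepFun (fun p : Fin K × Fin L => φ p.1 p.2) P) (hG : 0 < thetaMin G) (hK : 0 < K)
    (ht0 : 0 ≤ t) (ht1 : t ≤ 1) (S : ℕ) :
    P.real {ω | ∃ x ∈ sparseSphere S L,
        2 * (K * t * thetaMax G ^ 2) < |energyDeviation G (fun k i => φ k i ω) x|} ≤
      2 * Real.exp (6 * (S * Real.log L) - K * t ^ 2 / (2048 * (κ + 1) ^ 2)) := by
  have hL := pos_of_thetaMin_pos hG
  obtain ⟨A, hball, hcard, htest⟩ := exists_isQuadraticTestSet_sparseSphere hL S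
  have hcard' : (A.card : ℝ) ≤ Real.exp (6 * (S * Real.log L)) :=
    calc (A.card : ℝ) ≤ (L : ℝ) ^ (6 * S) := mod_cast hcard
      _ = Real.exp (6 * (S * Real.log L)) := by
        rw [← Real.exp_log (pow_pos (Nat.cast_pos.2 hL) _), Real.log_pow]
        push_cast
        rw [mul_assoc]
  have hunion := htest.measureReal_exists_lt_le (P := P)
    (fun ω => energyDeviation G fun k i => φ k i ω) fun y hy =>
      measureReal_abs_energyDeviation_ge_le hφ hvar hind (hG.trans_le (thetaMin_le_thetaMax hG))
        hK ht0 ht1 (mem_closedBall_zero_iff.1 (hball hy))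
  refine hunion.trans ?_
  rw [sub_eq_add_neg, Real.exp_add, mul_left_comm]
  gcongr

end UniformDeviation

lemma entropy_sub_exponent_le {α k s δ μ : ℝ} (hα : 0 < α) (hk : 0 ≤ k) (hδ : 0 < δ) (hμ : 0 < μ)
    (h : 48 * α * ((δ ^ 2)⁻¹ * μ ^ 2 * s) ≤ k) :
    6 * s - k * (δ / (2 * μ)) ^ 2 / α ≤
      -(1 / (2 * α) * k * min (δ / (2 * μ)) (δ ^ 2 / (2 * μ) ^ 2)) := by
  have hentropy : 12 * s ≤ k * (δ / (2 * μ)) ^ 2 / α :=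
    calc 12 * s = 48 * α * ((δ ^ 2)⁻¹ * μ ^ 2 * s) * (δ / (2 * μ)) ^ 2 / α := by
          field_simp; ring
      _ ≤ k * (δ / (2 * μ)) ^ 2 / α := by gcongr
  have hmin : 1 / (2 * α) * k * min (δ / (2 * μ)) (δ ^ 2 / (2 * μ) ^ 2) ≤
      k * (δ / (2 * μ)) ^ 2 / α / 2 :=
    calc 1 / (2 * α) * k * min (δ / (2 * μ)) (δ ^ 2 / (2 * μ) ^ 2)
        ≤ 1 / (2 * α) * k * (δ ^ 2 / (2 * μ) ^ 2) := by gcongr; exact min_le_right _ _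
      _ = k * (δ / (2 * μ)) ^ 2 / α / 2 := by field_simp
  linarith

lemma one_sub_le_measureReal_of_compl_subset {Ω : Type*} [MeasurableSpace Ω] {P : Measure Ω}
    [IsProbabilityMeasure P] {s t : Set Ω} (h : sᶜ ⊆ t) : 1 - P.real t ≤ P.real s := by
  have huniv : s ∪ t = Set.univ := Set.compl_subset_iff_union.1 h
  rw [sub_le_iff_le_add, ← probReal_univ (μ := P), ← huniv]
  exact measureReal_union_le s t

end MaskImaging

open MaskImaging in
theorem theorem2_general (κ : NNReal) :
    ∃ c C : ℝ, 0 < c ∧ 0 < C ∧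
      ∀ (N L K S : ℕ) (G : Matrix (Fin N) (Fin L) ℝ), 0 < thetaMin G →
      ∀ (δ : ℝ), 0 < δ → δ < 1 →
      ∀ {Ω : Type*} [MeasurableSpace Ω] (P : Measure Ω) [IsProbabilityMeasure P]
        (φ : Fin K → Fin L → Ω → ℝ),
        (∀ k i, HasSubgaussianMGF (φ k i) κ P) →
        (∀ k i, Var[φ k i; P] = 1) →
        iIndepFun (fun p : Fin K × Fin L => φ p.1 p.2) P →
        c * ((δ ^ 2)⁻¹ * condRatio G ^ 2 * (S : ℝ) * Real.log (L : ℝ)) ≤ (K : ℝ) →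
        1 - 2 * Real.exp (-(C * (K : ℝ) *
            min (δ / (2 * condRatio G)) (δ ^ 2 / (2 * condRatio G) ^ 2))) ≤
          P.real {ω |
            (∀ x ∈ sparseSphere S L,
              |‖Matrix.toEuclideanLin (measurementMatrix G fun k i => φ k i ω) x‖ ^ 2 /
                  ((K : ℝ) * thetaAvgSq G) - 1| ≤
                (condRatio G - 1 + 2 * δ) / (condRatio G + 1)) ∧
            HasRIP ((√((K : ℝ) * thetaAvgSq G))⁻¹ • measurementMatrix G fun k i => φ k i ω) S
              ((condRatio G - 1 + 2 * δ) / (condRatio G + 1))} := by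
  set α : ℝ := 2048 * (κ + 1) ^ 2
  refine ⟨48 * α, 1 / (2 * α), by positivity, by positivity, ?_⟩
  intro N L K S G hG δ hδ0 hδ1 Ω _ P _ φ hφ hvar hind hK
  obtain rfl | hK0 := K.eq_zero_or_pos
  · exact le_trans (by norm_num) measureReal_nonneg
  have hμ := one_le_condRatio hG
  have hmax : 0 < thetaMax G := hG.trans_le (thetaMin_le_thetaMax hG)
  set t := δ / (2 * condRatio G) with ht
  have ht1 : t ≤ 1 := by rw [ht, div_le_one (by positivity)]; linarith
  have hscale : 2 * (K * t * thetaMax G ^ 2) = K * δ * thetaMin G ^ 2 := by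
    rw [ht, condRatio]; field_simp
  have hbad := measureReal_exists_sparseSphere_energyDeviation_gt_le hφ hvar hind hG hK0
    (by positivity) ht1 S
  have hexp := Real.exp_le_exp.2 (entropy_sub_exponent_le (α := α) (μ := condRatio G)
    (s := S * Real.log L) (by positivity) K.cast_nonneg hδ0 (by positivity)
    (by rwa [← mul_assoc (_⁻¹ * _)]))
  refine (sub_le_sub_left (hbad.trans (mul_le_mul_of_nonneg_left hexp zero_le_two)) 1).trans
    (one_sub_le_measureReal_of_compl_subset ?_)
  rw [Set.compl_subset_comm]
  intro ω hω
  simp only [Set.mem_compl_iff, Set.mem_ofPred_eq, not_exists, not_and, not_lt, hscale] at hω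
  have hisometry := fun x hx =>
    abs_norm_sq_div_sub_one_le_of_abs_energyDeviation_le hG hK0 hx.1 (hω x hx)
  exact ⟨hisometry, hasRIP_of_abs_norm_sq_div_sub_one_le hG hδ0 hδ1 hisometry⟩

open MaskImaging in
theorem theorem2 :
    ∃ c C : ℝ, 0 < c ∧ 0 < C ∧
      ∀ (N L K S : ℕ), 0 < L →
      ∀ (G : Matrix (Fin N) (Fin L) ℝ), 0 < thetaMin G →
      ∀ (δ : ℝ), 0 < δ → δ < 1 →
      ∀ {Ω : Type*} [MeasurableSpace Ω] (P : Measure Ω) [IsProbabilityMeasure P]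
        (φ : Fin K → Fin L → Ω → ℝ),
        (∀ k i, HasLaw (φ k i) rademacher P) →
        iIndepFun (fun p : Fin K × Fin L => φ p.1 p.2) P →
        c * ((δ ^ 2)⁻¹ * condRatio G ^ 2 * (S : ℝ) * Real.log (L : ℝ)) ≤ (K : ℝ) →
        1 - 2 * Real.exp (-(C * (K : ℝ) *
            min (δ / (2 * condRatio G)) (δ ^ 2 / (2 * condRatio G) ^ 2))) ≤
          P.real {ω |
            (∀ x ∈ sparseSphere S L,
              |‖Matrix.toEuclideanLin (measurementMatrix G fun k i => φ k i ω) x‖ ^ 2 /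
                  ((K : ℝ) * thetaAvgSq G) - 1| ≤
                (condRatio G - 1 + 2 * δ) / (condRatio G + 1)) ∧
            HasRIP ((√((K : ℝ) * thetaAvgSq G))⁻¹ • measurementMatrix G fun k i => φ k i ω) S
              ((condRatio G - 1 + 2 * δ) / (condRatio G + 1))} := by
  obtain ⟨c, C, hc, hC, h⟩ := theorem2_general 1
  exact ⟨c, C, hc, hC, fun N L K S _ G hG δ hδ0 hδ1 _ _ P _ φ hφ => h N L K S G hG δ hδ0 hδ1 P φ
    (fun k i => hasSubgaussianMGF_of_hasLaw_rademacher (hφ k i))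
    fun k i => variance_eq_one_of_hasLaw_rademacher (hφ k i)⟩
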